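/- Let $\tilde{\mathcal H}$ and $\mathcal H$ be finite-dimensional complex Hilbert spaces, let $V:\tilde{\mathcal H}\to\mathcal H$ be an isometry, and let $\mathcal C=V\tilde{\mathcal H}\subseteq\mathcal H$ be the code subspace. Let $\mathcal E$ be a quantum channel (a completely positive trace-preserving linear map) on the operators of $\mathcal H$, with a Kraus representation $\mathcal E(\rho)=\sum_{a=1}^{r}E_a\rho E_a^\dagger$; write $K=\{E_a\}_{a=1}^r$ and $|K|=r$. Let $\mathcal E_{\mathcal I}=\tfrac12\mathcal I+\tfrac12\mathcal E$, where $\mathcal I$ is the identity channel, and let $\delta\in\mathbb R$. For a normal operator $\tilde T$ on $\tilde{\mathcal H}$, an operator $T$ on $\mathcal H$ is a $\delta$-approximate ghost logical operator for $\tilde T$ with respect to $(\mathcal E,K)$ if, in operator norm, $\|TE V-EV\tilde T\|\le\delta\,\|\tilde T\|$ for every $E\in K\cup\{I\}$. A complete set of $\delta$-approximate ghost logical operators exists if every normal $\tilde T$ on $\tilde{\mathcal H}$ has a $\delta$-approximate ghost logical operator $T$, which can be chosen self-adjoint whenever $\tilde T$ is self-adjoint. For channels $\mathcal M,\mathcal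 N$ on the operators of $\mathcal H$, let $$\mathfrak B_{\mathcal C}(\mathcal M,\mathcal N)=\sup_\rho\sqrt{1-F_\rho(\mathcal M,\mathcal N)},\qquad F_\rho(\mathcal M,\mathcal N)=f\big[(\mathcal M\otimes\mathcal I)(|\psi\rangle\langle\psi|),(\mathcal N\otimes\mathcal I)(|\psi\rangle\langle\psi|)\big],$$ where $\rho$ ranges over the density operators supported on $\mathcal C$, $|\psi\rangle$ is a purification of $\rho$ by a finite-dimensional reference system (the value does not depend on which one), and $f(\rho,\tau)=\mathrm{Tr}\sqrt{\sqrt\tau\,\rho\,\sqrt\tau}$. The channel $\mathcal N$ is $\epsilon$-correctable for $\mathcal C$ if there is a channel $\mathcal R$ on the operators of $\mathcal H$ with $\mathfrak B_{\mathcal C}(\mathcal R\circ\mathcal N,\mathcal I)\le\epsilon$. **Theorem.** If a complete set of $\delta$-approximate ghost logical operators exists for $\mathcal E$ and its Kraus operators $K$, then $\mathcal E_{\mathcal I}$ is $\epsilon$-correctable for $\mathcal C$ with $$\epsilon=(|K|+1)\sqrt{2(\dim\mathcal C)\,\delta}.$$ -/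

import Mathlib

open scoped Matrix.Norms.L2Operator MatrixOrder ComplexOrder Matrix

noncomputable section

namespace GhostCode

/-! Finite-dimensional Hilbert spaces are written as `n → ℂ` with a finite index type `n`
(an orthonormal basis), and operators between them as complex matrices. The norm of a matrix is
the operator norm induced by the Hilbert space norms. -/

/-- Superoperators: linear maps on the operators of the Hilbert space `n → ℂ`. -/
abbrev SuperOp (n : Type*) := Matrix n n ℂ →ₗ[ℂ] Matrix n n ℂ

/-- The amplification `Φ ⊗ id` of a superoperator by a reference system with basis `r`:
`Φ` is applied to each block `⟨a|X|b⟩` of an operator `X` on the composite system. -/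
def amplify {n : Type*} (r : Type*) (Φ : SuperOp n) (X : Matrix (n × r) (n × r) ℂ) :
    Matrix (n × r) (n × r) ℂ :=
  Matrix.of fun p q => Φ (Matrix.of fun i j => X (i, p.2) (j, q.2)) p.1 q.1

/-- A quantum channel: a completely positive trace-preserving linear map. -/
structure IsChannel {n : Type*} [Fintype n] (Φ : SuperOp n) : Prop where
  completely_positive : ∀ (k : ℕ) (X : Matrix (n × Fin k) (n × Fin k) ℂ),
    X.PosSemidef → (amplify (Fin k) Φ X).PosSemidef
  trace_preserving : ∀ X : Matrix n n ℂ, (Φ X).trace = X.trace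

/-- The family `E` of operators is a Kraus representation of `Φ`. -/
def IsKrausRep {n ι : Type*} [Fintype n] [Fintype ι] (E : ι → Matrix n n ℂ) (Φ : SuperOp n) :
    Prop :=
  ∀ X : Matrix n n ℂ, Φ X = ∑ a, E a * X * (E a)ᴴ

/-- The channel that applies `Φ` with probability `1/2` and does nothing with
probability `1/2`. -/
def withIdentity {n : Type*} (Φ : SuperOp n) : SuperOp n :=
  (1 / 2 : ℂ) • LinearMap.id + (1 / 2 : ℂ) • Φ

/-- Density operators. -/
structure IsDensity {n : Type*} [Fintype n] (ρ : Matrix n n ℂ) : Prop where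
  posSemidef : ρ.PosSemidef
  trace_eq_one : ρ.trace = 1

/-- The rank one operator `|ψ⟩⟨ψ|`. -/
def ketBra {n : Type*} (ψ : n → ℂ) : Matrix n n ℂ :=
  Matrix.vecMulVec ψ (star ψ)

/-- The partial trace over the second tensor factor. -/
def partialTrace {n r : Type*} [Fintype r] (X : Matrix (n × r) (n × r) ℂ) : Matrix n n ℂ :=
  Matrix.of fun i j => ∑ a, X (i, a) (j, a)

/-- The vector `ψ` of the system with a reference system `r` adjoined is a purification
of `ρ`. -/
def IsPurification {n r : Type*} [Fintype r] (ψ : n × r → ℂ) (ρ : Matrix n n ℂ) : Prop :=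
  partialTrace (ketBra ψ) = ρ

/-- The fidelity `Tr √(√τ ρ √τ)` of two positive semidefinite operators. -/
def fidelity {n : Type*} [Fintype n] [DecidableEq n] (ρ τ : Matrix n n ℂ) : ℝ :=
  (Matrix.trace (CFC.sqrt (CFC.sqrt τ * ρ * CFC.sqrt τ))).re

/-- The entanglement fidelity of `Φ` and `Ψ` with respect to a state with purification `ψ`. -/
def entanglementFidelity {n r : Type*} [Fintype n] [DecidableEq n] [Fintype r] [DecidableEq r]
    (Φ Ψ : SuperOp n) (ψ : n × r → ℂ) : ℝ :=
  fidelity (amplify r Φ (ketBra ψ)) (amplify r Ψ (ketBra ψ))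

/-- A state of the code `C`: a density operator with support in the subspace `C`. -/
def IsCodeState {n : Type*} [Fintype n] (C : Submodule ℂ (n → ℂ)) (ρ : Matrix n n ℂ) : Prop :=
  IsDensity ρ ∧ ∀ x : n → ℂ, ρ *ᵥ x ∈ C

/-- The Bures distance of `Φ` and `Ψ` on the code `C`: the worst case of `√(1 - F)` over the
states `ρ` of the code, where `F` is computed from a purification of `ρ`. (The value of `F` is
the same for all purifications of `ρ`; all of them, with all finite reference systems, are
admitted.) -/
def buresDist {n : Type*} [Fintype n] [DecidableEq n] (C : Submodule ℂ (n → ℂ))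
    (Φ Ψ : SuperOp n) : ℝ :=
  sSup {b : ℝ | ∃ (ρ : Matrix n n ℂ) (k : ℕ) (ψ : n × Fin k → ℂ),
    IsCodeState C ρ ∧ IsPurification ψ ρ ∧ b = √(1 - entanglementFidelity Φ Ψ ψ)}

/-- The noise channel `Φ` is `ε`-correctable with respect to the code `C`. -/
def IsCorrectable {n : Type*} [Fintype n] [DecidableEq n] (C : Submodule ℂ (n → ℂ))
    (Φ : SuperOp n) (ε : ℝ) : Prop :=
  ∃ R : SuperOp n, IsChannel R ∧ buresDist C (R ∘ₗ Φ) LinearMap.id ≤ ε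

/-- The code subspace, i.e. the image of the encoding map `V`. -/
def codeSpace {n m : Type*} [Fintype m] (V : Matrix n m ℂ) : Submodule ℂ (n → ℂ) :=
  LinearMap.range V.mulVecLin

/-- `T` is a `δ`-approximate ghost operator for the logical operator `S`, with respect to the
encoding `V` and the Kraus operators `E`: the bound holds for each Kraus operator and for the
identity. -/
structure IsApproxGhost {n m ι : Type*} [Fintype n] [DecidableEq n] [Fintype m] [DecidableEq m]
    (V : Matrix n m ℂ) (E : ι → Matrix n n ℂ) (δ : ℝ) (S : Matrix m m ℂ) (T : Matrix n n ℂ) :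
    Prop where
  kraus : ∀ a, ‖T * E a * V - E a * V * S‖ ≤ ‖S‖ * δ
  identity : ‖T * V - V * S‖ ≤ ‖S‖ * δ

/-- There is a complete set of `δ`-approximate ghost operators: each normal logical operator
has one, and each self-adjoint logical operator has a self-adjoint one. -/
def HasCompleteGhostSet {n m ι : Type*} [Fintype n] [DecidableEq n] [Fintype m] [DecidableEq m]
    (V : Matrix n m ℂ) (E : ι → Matrix n n ℂ) (δ : ℝ) : Prop :=
  ∀ S : Matrix m m ℂ, IsStarNormal S →
    ∃ T : Matrix n n ℂ, IsApproxGhost V E δ S T ∧ (S.IsHermitian → T.IsHermitian)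

end GhostCode

end

open scoped ComplexStarModule Kronecker

noncomputable section

namespace GhostCode

/-! ### Operator norm estimates -/

section OperatorNorm

variable {m n : Type*} [Fintype m] [DecidableEq m] [Fintype n]

/-! Ghost operators force the approximate Knill–Laflamme conditions. If `T` is a self-adjoint ghost
operator for `S`, then in the commutator of `S` with `(E_a V)† (E_b V)` the operator `S` can be
traded for `T` on either side, and the terms containing `T` cancel
(`HasCompleteGhostSet.norm_commutator_le`). A matrix that almost commutes with everything is almost
scalar (`norm_sub_scalar_le_of_commutator`).

For recovery (`exists_recovery`), put the blocks `F_a V` side by side into one matrix `W`, with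
polar decomposition `W = U √A`, `A = W† W`. The conditions say that `A` is blockwise close to `1 ⊗
l` for a positive `l`. Undoing `U` and discarding the block label leaves Kraus operators whose
distance from multiples of `V` is the Hilbert–Schmidt distance of `√A` from `1 ⊗ √l`. Powers–Størmer
(`exists_contraction_hsNormSq_sub_le`) bounds its square by the trace norm of `A - 1 ⊗ l`, which is
estimated block by block. Finally `one_sub_entanglementFidelity_le` turns this distance into a
fidelity bound uniform over code states. -/

theorem norm_matrix_le_of_mulVec (A : Matrix n m ℂ) {c : ℝ} (hc : 0 ≤ c)
    (h : ∀ x : EuclideanSpace ℂ m, ‖WithLp.toLp 2 (A *ᵥ x)‖ ≤ c * ‖x‖) : ‖A‖ ≤ c := by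
  rw [Matrix.l2_opNorm_def]
  exact ContinuousLinearMap.opNorm_le_bound _ hc h

theorem norm_vecMulVec_single_le (y : EuclideanSpace ℂ n) (i : m) :
    ‖Matrix.vecMulVec y (Pi.single i 1 : m → ℂ)‖ ≤ ‖y‖ := by
  refine norm_matrix_le_of_mulVec _ (norm_nonneg _) fun x => ?_
  have : WithLp.toLp 2 (Matrix.vecMulVec y (Pi.single i 1 : m → ℂ) *ᵥ x) = x i • y := by
    ext j
    simp [Matrix.vecMulVec_mulVec, mul_comm]
  rw [this, norm_smul, mul_comm]
  gcongr
  exact PiLp.norm_apply_le x i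

/-- A matrix almost commuting with all Hermitian matrices almost commutes with all matrices. -/
theorem norm_commutator_le_of_hermitian {X : Matrix m m ℂ} {c : ℝ} (hc : 0 ≤ c)
    (h : ∀ S : Matrix m m ℂ, S.IsHermitian → ‖X * S - S * X‖ ≤ c * ‖S‖) (S : Matrix m m ℂ) :
    ‖X * S - S * X‖ ≤ 2 * c * ‖S‖ := by
  have h1 := h (ℜ S) (ℜ S).2
  have h2 := h (ℑ S) (ℑ S).2
  have n1 : ‖((ℜ S : selfAdjoint (Matrix m m ℂ)) : Matrix m m ℂ)‖ ≤ ‖S‖ := realPart.norm_le S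
  have n2 : ‖((ℑ S : selfAdjoint (Matrix m m ℂ)) : Matrix m m ℂ)‖ ≤ ‖S‖ :=
    imaginaryPart.norm_le S
  -- The factor 2 is the cost of treating the real and imaginary parts separately.
  have e : X * S - S * X = (X * (ℜ S : Matrix m m ℂ) - (ℜ S : Matrix m m ℂ) * X) +
      Complex.I • (X * (ℑ S : Matrix m m ℂ) - (ℑ S : Matrix m m ℂ) * X) := by
    conv_lhs => rw [← realPart_add_I_smul_imaginaryPart S]
    rw [mul_add, add_mul, mul_smul_comm, smul_mul_assoc, smul_sub]
    abel
  rw [e]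
  refine (norm_add_le _ _).trans ?_
  rw [norm_smul, Complex.norm_I, one_mul]
  nlinarith [mul_le_mul_of_nonneg_left n1 hc, mul_le_mul_of_nonneg_left n2 hc]

/-- A matrix almost commuting with all matrices is almost scalar. -/
theorem norm_sub_scalar_le_of_commutator {X : Matrix m m ℂ} {c : ℝ} (hc : 0 ≤ c)
    (h : ∀ S : Matrix m m ℂ, ‖X * S - S * X‖ ≤ c * ‖S‖) (i : m) :
    ‖X - X i i • (1 : Matrix m m ℂ)‖ ≤ c := by
  refine norm_matrix_le_of_mulVec _ hc fun y => ?_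
  -- For `S = |y⟩⟨i|`, `X S` sends the basis vector `i` to `X y`, while `S X` sends it to `X i i •
  -- y`.
  set S : Matrix m m ℂ := Matrix.vecMulVec y (Pi.single i 1 : m → ℂ)
  have e : (X - X i i • (1 : Matrix m m ℂ)) *ᵥ y =
      (X * S - S * X) *ᵥ (EuclideanSpace.single i (1 : ℂ)) := by
    ext j
    simp [S, Matrix.sub_mulVec, Matrix.smul_mulVec, Matrix.mul_vecMulVec, Matrix.vecMulVec_mul,
      Matrix.vecMulVec_apply, mul_comm]
  rw [e]
  refine (Matrix.l2_opNorm_mulVec _ _).trans ?_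
  rw [PiLp.norm_single, norm_one, mul_one]
  exact (h S).trans (mul_le_mul_of_nonneg_left (norm_vecMulVec_single_le y i) hc)

theorem norm_le_one_of_conjTranspose_mul_self_le_one {A : Matrix n m ℂ} (h : Aᴴ * A ≤ 1) :
    ‖A‖ ≤ 1 := by
  have h0 : (0 : Matrix m m ℂ) ≤ Aᴴ * A :=
    Matrix.nonneg_iff_posSemidef.2 (Matrix.posSemidef_conjTranspose_mul_self A)
  have h1 := (CStarAlgebra.norm_le_one_iff_of_nonneg (Aᴴ * A) h0).2 h
  rw [Matrix.l2_opNorm_conjTranspose_mul_self] at h1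
  nlinarith [norm_nonneg A]

theorem mul_conjTranspose_self_le_one_of_norm_le_one [DecidableEq n] {A : Matrix n m ℂ} (h : ‖A‖ ≤ 1) :
    A * Aᴴ ≤ 1 := by
  have h0 : (0 : Matrix n n ℂ) ≤ A * Aᴴ :=
    Matrix.nonneg_iff_posSemidef.2 (Matrix.posSemidef_self_mul_conjTranspose A)
  refine (CStarAlgebra.norm_le_one_iff_of_nonneg (A * Aᴴ) h0).1 ?_
  have := Matrix.l2_opNorm_conjTranspose_mul_self Aᴴ
  rw [Matrix.conjTranspose_conjTranspose, Matrix.l2_opNorm_conjTranspose] at this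
  rw [this]
  nlinarith [norm_nonneg A]

theorem norm_apply_le_norm (A : Matrix n m ℂ) (i : n) (j : m) : ‖A i j‖ ≤ ‖A‖ := by
  have h := Matrix.l2_opNorm_mulVec A (EuclideanSpace.single j (1 : ℂ))
  rw [PiLp.norm_single, norm_one, mul_one] at h
  refine le_trans ?_ ((PiLp.norm_apply_le _ i).trans h)
  simp

theorem norm_trace_le (A : Matrix m m ℂ) : ‖A.trace‖ ≤ Fintype.card m * ‖A‖ := by
  refine (norm_sum_le _ _).trans ?_
  refine (Finset.sum_le_sum fun i _ => norm_apply_le_norm A i i).trans ?_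
  simp

end OperatorNorm

/-! ### The Hilbert–Schmidt norm -/

section HilbertSchmidt

variable {m n p : Type*} [Fintype m] [Fintype n] [Fintype p]

/-- The square of the Hilbert–Schmidt norm. -/
def hsNormSq (A : Matrix n m ℂ) : ℝ := (Aᴴ * A).trace.re

theorem hsNormSq_eq_sum (A : Matrix n m ℂ) : hsNormSq A = ∑ i, ∑ j, ‖A i j‖ ^ 2 := by
  rw [hsNormSq, Matrix.trace, Finset.sum_comm]
  simp only [Matrix.diag_apply, Matrix.mul_apply, Matrix.conjTranspose_apply, Complex.re_sum]
  refine Finset.sum_congr rfl fun j _ => Finset.sum_congr rfl fun i _ => ?_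
  rw [← Complex.normSq_eq_norm_sq, Complex.star_def, mul_comm, Complex.mul_conj,
    Complex.ofReal_re]

theorem hsNormSq_nonneg (A : Matrix n m ℂ) : 0 ≤ hsNormSq A := by
  rw [hsNormSq_eq_sum]
  positivity

theorem hsNormSq_mul_le (A : Matrix n m ℂ) (B : Matrix m p ℂ) :
    hsNormSq (A * B) ≤ hsNormSq A * hsNormSq B := by
  simp only [hsNormSq_eq_sum]
  rw [Finset.sum_mul]
  refine Finset.sum_le_sum fun i _ => ?_
  rw [Finset.sum_comm (s := Finset.univ (α := m)), Finset.mul_sum]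
  refine Finset.sum_le_sum fun k _ => ?_
  rw [Matrix.mul_apply]
  refine le_trans ?_ (Finset.sum_mul_sq_le_sq_mul_sq _ _ _)
  gcongr
  refine (norm_sum_le _ _).trans_eq ?_
  simp

theorem hsNormSq_isometry_mul [DecidableEq m] {V : Matrix n m ℂ} (hV : Vᴴ * V = 1)
    (A : Matrix m p ℂ) : hsNormSq (V * A) = hsNormSq A := by
  rw [hsNormSq, hsNormSq, Matrix.conjTranspose_mul, Matrix.mul_assoc, ← Matrix.mul_assoc Vᴴ, hV,
    Matrix.one_mul]

theorem trace_mul_re_nonneg [DecidableEq m] {A B : Matrix m m ℂ} (hA : A.PosSemidef)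
    (hB : B.PosSemidef) : 0 ≤ (A * B).trace.re := by
  have h : (A * B).trace = (CFC.sqrt A * B * (CFC.sqrt A)ᴴ).trace := by
    have hs : (CFC.sqrt A)ᴴ = CFC.sqrt A :=
      (Matrix.nonneg_iff_posSemidef.1 (CFC.sqrt_nonneg A)).1
    rw [hs, Matrix.trace_mul_comm (_ * B), ← Matrix.mul_assoc,
      CFC.sqrt_mul_sqrt_self A (Matrix.nonneg_iff_posSemidef.2 hA)]
  rw [h]
  exact (Complex.le_def.1 (hB.mul_mul_conjTranspose_same _).trace_nonneg).1

/-- The Powers–Størmer inequality, with the trace norm in its dual form. -/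
theorem exists_contraction_hsNormSq_sub_le [DecidableEq m] {A B : Matrix m m ℂ}
    (hA : A.PosSemidef) (hB : B.PosSemidef) :
    ∃ Q : Matrix m m ℂ, ‖Q‖ ≤ 1 ∧ hsNormSq (A - B) ≤ (Q * (A * A - B * B)).trace.re := by
  set D := A - B with hD
  have hDh : D.IsHermitian := hA.1.sub hB.1
  have hDs : IsSelfAdjoint D := hDh
  have hcont : ∀ f : ℝ → ℝ, ContinuousOn f (spectrum ℝ D) := fun f =>
    D.finite_real_spectrum.continuousOn f
  -- `Q` is the sign of `D`, and `P`, `N` are its positive and negative parts, so `Q D = D Q = P + N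
  -- = |D|`.
  set Q := cfc (fun x : ℝ => (SignType.sign x : ℝ)) D with hQ
  set P := cfc (fun x : ℝ => max x 0) D with hP
  set N := cfc (fun x : ℝ => max (-x) 0) D with hN
  have hPpos : P.PosSemidef :=
    Matrix.nonneg_iff_posSemidef.1 (cfc_nonneg fun x _ => le_max_right _ _)
  have hNpos : N.PosSemidef :=
    Matrix.nonneg_iff_posSemidef.1 (cfc_nonneg fun x _ => le_max_right _ _)
  have hPN : P - N = D := by
    rw [hP, hN, ← cfc_sub _ _ D (hcont _) (hcont _)]
    conv_rhs => rw [← cfc_id' ℝ D hDs]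
    refine cfc_congr fun x _ => ?_
    rcases le_total x 0 with h | h <;> simp [h]
  have key : ∀ x : ℝ, (SignType.sign x : ℝ) * x = max x 0 + max (-x) 0 := fun x => by
    rcases lt_trichotomy x 0 with h | h | h
    · simp [h, h.le]
    · simp [h]
    · simp [h, h.le]
  have hQD : Q * D = P + N := by
    rw [hP, hN, ← cfc_add D _ _ (hcont _) (hcont _), hQ]
    nth_rewrite 2 [← cfc_id' ℝ D hDs]
    rw [← cfc_mul _ _ D (hcont _) (hcont _)]
    exact cfc_congr fun x _ => key x
  have hDQ : D * Q = P + N := by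
    rw [hP, hN, ← cfc_add D _ _ (hcont _) (hcont _), hQ]
    nth_rewrite 1 [← cfc_id' ℝ D hDs]
    rw [← cfc_mul _ _ D (hcont _) (hcont _)]
    exact cfc_congr fun x _ => by rw [mul_comm]; exact key x
  refine ⟨Q, norm_cfc_le zero_le_one fun x _ => ?_, ?_⟩
  · rcases lt_trichotomy x 0 with h | h | h <;> simp [h]
  have e1 : (Q * (A * A - B * B)).trace = ((P + N) * (A + B)).trace := by
    -- `A` and `B` need not commute, so the difference of squares is factored symmetrically.
    have h1 : A * A - B * B = (1 / 2 : ℂ) • (D * (A + B)) + (1 / 2 : ℂ) • ((A + B) * D) := by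
      rw [hD, ← smul_add]
      have : (A - B) * (A + B) + (A + B) * (A - B) = (2 : ℂ) • (A * A - B * B) := by
        rw [two_smul]; noncomm_ring
      rw [this, smul_smul]; norm_num
    rw [h1, Matrix.mul_add, Matrix.trace_add, Matrix.mul_smul, Matrix.mul_smul,
      Matrix.trace_smul, Matrix.trace_smul, ← Matrix.mul_assoc, hQD, ← Matrix.mul_assoc,
      Matrix.trace_mul_comm (Q * (A + B)) D, ← Matrix.mul_assoc, hDQ, smul_eq_mul]
    ring
  -- The excess is a sum of products of positive matrices, hence has nonnegative trace.
  have e2 : (P + N) * (A + B) - Dᴴ * D = (2 : ℂ) • (P * B) + (2 : ℂ) • (N * A) := by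
    rw [hDh.eq]
    have : D * D = (P - N) * (A - B) := by rw [hPN]
    rw [this, two_smul, two_smul]
    noncomm_ring
  have e3 := congrArg (fun M => (Matrix.trace M).re) e2
  simp only [Matrix.trace_sub, Matrix.trace_add, Matrix.trace_smul, Complex.sub_re,
    Complex.add_re, smul_eq_mul, Complex.mul_re, Complex.re_ofNat, Complex.im_ofNat,
    zero_mul, sub_zero] at e3
  have p1 := trace_mul_re_nonneg hPpos hB
  have p2 := trace_mul_re_nonneg hNpos hA
  rw [e1, hsNormSq]
  linarith

end HilbertSchmidt

/-! ### Polar decomposition -/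

/-- `U` is `W` times the pseudo-inverse of `√(W† W)`. `W` need not be injective, so `U` is only
claimed to be a contraction. -/
theorem exists_polar {n m : Type*} [Fintype n] [DecidableEq n] [Fintype m] [DecidableEq m]
    (W : Matrix n m ℂ) :
    ∃ U : Matrix n m ℂ, ‖U‖ ≤ 1 ∧ Uᴴ * W = CFC.sqrt (Wᴴ * W) := by
  set A := Wᴴ * W with hA
  have hApos : A.PosSemidef := Matrix.posSemidef_conjTranspose_mul_self W
  have hA0 : 0 ≤ A := Matrix.nonneg_iff_posSemidef.2 hApos
  have hAs : IsSelfAdjoint A := hApos.1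
  have hcont : ∀ f : ℝ → ℝ, ContinuousOn f (spectrum ℝ A) := fun f =>
    A.finite_real_spectrum.continuousOn f
  -- The convention `0⁻¹ = 0` makes this the pseudo-inverse on the kernel of `A`.
  set R := cfc (fun x : ℝ => (√x)⁻¹) A with hR
  have hRs : Rᴴ = R := (cfc_predicate (p := IsSelfAdjoint) (fun x : ℝ => (√x)⁻¹) A)
  have hRA : R * A = cfc Real.sqrt A := by
    rw [hR]
    nth_rewrite 2 [← cfc_id' ℝ A hAs]
    rw [← cfc_mul _ _ A (hcont _) (hcont _)]
    refine cfc_congr fun x hx => ?_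
    have hx0 : 0 ≤ x := spectrum_nonneg_of_nonneg hA0 hx
    rcases hx0.eq_or_lt with h | h
    · simp [← h]
    · have := Real.sqrt_pos.2 h
      field_simp
      exact (Real.sq_sqrt hx0).symm
  refine ⟨W * R, ?_, ?_⟩
  · refine norm_le_one_of_conjTranspose_mul_self_le_one ?_
    rw [Matrix.conjTranspose_mul, hRs, Matrix.mul_assoc, ← Matrix.mul_assoc Wᴴ, ← hA,
      ← Matrix.mul_assoc, hRA, hR, ← cfc_mul _ _ A (hcont _) (hcont _)]
    refine cfc_le_one _ _ fun x _ => ?_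
    exact mul_inv_le_one
  · rw [Matrix.conjTranspose_mul, hRs, Matrix.mul_assoc, ← hA, hRA,
      CFC.sqrt_eq_real_sqrt A hA0, cfcₙ_eq_cfc (hf := Real.continuous_sqrt.continuousOn)]

/-! ### Kraus representations -/

section Kraus

variable {n κ κ' : Type*} [Fintype n] [Fintype κ] [Fintype κ']

/-- The superoperator with given Kraus operators. -/
def ofKraus (G : κ → Matrix n n ℂ) : SuperOp n where
  toFun X := ∑ a, G a * X * (G a)ᴴ
  map_add' X Y := by simp only [mul_add, add_mul, Finset.sum_add_distrib]
  map_smul' c X := by simp [Finset.smul_sum]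

theorem isKrausRep_ofKraus (G : κ → Matrix n n ℂ) : IsKrausRep G (ofKraus G) := fun _ => rfl

theorem IsKrausRep.comp {G : κ → Matrix n n ℂ} {F : κ' → Matrix n n ℂ} {Φ Ψ : SuperOp n}
    (hG : IsKrausRep G Φ) (hF : IsKrausRep F Ψ) :
    IsKrausRep (fun k : κ × κ' => G k.1 * F k.2) (Φ ∘ₗ Ψ) := fun X => by
  rw [LinearMap.comp_apply, hG, hF, Fintype.sum_prod_type]
  refine Finset.sum_congr rfl fun a _ => ?_
  rw [Finset.mul_sum, Finset.sum_mul]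
  refine Finset.sum_congr rfl fun b _ => ?_
  simp only [Matrix.conjTranspose_mul, Matrix.mul_assoc]

theorem sum_conjTranspose_mul_self_comp [DecidableEq n] {G : κ → Matrix n n ℂ}
    {F : κ' → Matrix n n ℂ} (hG : ∑ a, (G a)ᴴ * G a = 1) (hF : ∑ b, (F b)ᴴ * F b = 1) :
    ∑ k : κ × κ', (G k.1 * F k.2)ᴴ * (G k.1 * F k.2) = 1 := by
  rw [Fintype.sum_prod_type_right, ← hF]
  refine Finset.sum_congr rfl fun b _ => ?_
  calc ∑ a, (G a * F b)ᴴ * (G a * F b) = (F b)ᴴ * (∑ a, (G a)ᴴ * G a) * F b := by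
        rw [Finset.mul_sum, Finset.sum_mul]
        simp only [Matrix.conjTranspose_mul, Matrix.mul_assoc]
    _ = (F b)ᴴ * F b := by rw [hG, Matrix.mul_one]

/-- By cyclicity of the trace, both sides pair equally with every `X`, and the trace pairing is
nondegenerate. -/
theorem IsKrausRep.sum_conjTranspose_mul_self [DecidableEq n] {G : κ → Matrix n n ℂ}
    {Φ : SuperOp n} (hG : IsKrausRep G Φ) (hΦ : ∀ X, (Φ X).trace = X.trace) :
    ∑ a, (G a)ᴴ * G a = 1 := by
  refine Matrix.ext_iff_trace_mul_right.2 fun X => ?_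
  rw [Matrix.one_mul, ← hΦ X, hG X, Finset.sum_mul, Matrix.trace_sum, Matrix.trace_sum]
  refine Finset.sum_congr rfl fun a _ => ?_
  rw [Matrix.mul_assoc, Matrix.trace_mul_comm]

theorem IsKrausRep.amplify_eq [DecidableEq n] {r : Type*} [Fintype r] [DecidableEq r]
    {G : κ → Matrix n n ℂ} {Φ : SuperOp n} (hG : IsKrausRep G Φ)
    (X : Matrix (n × r) (n × r) ℂ) :
    amplify r Φ X = ∑ a, (G a ⊗ₖ (1 : Matrix r r ℂ)) * X * (G a ⊗ₖ (1 : Matrix r r ℂ))ᴴ := by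
  ext ⟨i, a⟩ ⟨j, b⟩
  rw [amplify, Matrix.of_apply, hG, Matrix.sum_apply, Matrix.sum_apply]
  refine Finset.sum_congr rfl fun k _ => ?_
  simp [Matrix.mul_apply, Fintype.sum_prod_type, Matrix.one_apply, Finset.sum_mul, apply_ite]

theorem IsKrausRep.isChannel [DecidableEq n] {G : κ → Matrix n n ℂ} {Φ : SuperOp n}
    (hG : IsKrausRep G Φ) (h1 : ∑ a, (G a)ᴴ * G a = 1) : IsChannel Φ where
  completely_positive k X hX := by
    rw [hG.amplify_eq]
    exact Matrix.posSemidef_sum _ fun a _ => hX.mul_mul_conjTranspose_same _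
  trace_preserving X := by
    rw [hG, Matrix.trace_sum]
    conv_rhs => rw [← Matrix.one_mul X, ← h1, Finset.sum_mul, Matrix.trace_sum]
    refine Finset.sum_congr rfl fun a _ => ?_
    rw [Matrix.mul_assoc ((G a)ᴴ), Matrix.trace_mul_comm ((G a)ᴴ)]

/-- Kraus operators of `withIdentity Φ`. -/
def idKraus [DecidableEq n] (E : κ → Matrix n n ℂ) (a : Option κ) : Matrix n n ℂ :=
  ((√(1 / 2) : ℝ) : ℂ) • a.elim 1 E

omit [Fintype κ] in
theorem idKraus_conjTranspose_mul_mul [DecidableEq n] (E : κ → Matrix n n ℂ)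
    (a b : Option κ) :
    (idKraus E a)ᴴ * idKraus E b = (1 / 2 : ℂ) • ((a.elim 1 E)ᴴ * b.elim 1 E) := by
  have h : ((√(1 / 2) : ℝ) : ℂ) * ((√(1 / 2) : ℝ) : ℂ) = 1 / 2 := by
    rw [← Complex.ofReal_mul, Real.mul_self_sqrt (by norm_num)]; norm_num
  rw [idKraus, idKraus, Matrix.conjTranspose_smul, Complex.star_def, Complex.conj_ofReal,
    Matrix.smul_mul, Matrix.mul_smul, smul_smul, h]

theorem isKrausRep_idKraus [DecidableEq n] {E : κ → Matrix n n ℂ} {Φ : SuperOp n}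
    (hE : IsKrausRep E Φ) : IsKrausRep (idKraus E) (withIdentity Φ) := fun X => by
  have h : ((√(1 / 2) : ℝ) : ℂ) * ((√(1 / 2) : ℝ) : ℂ) = 1 / 2 := by
    rw [← Complex.ofReal_mul, Real.mul_self_sqrt (by norm_num)]; norm_num
  have h2 : ∀ a, idKraus E a * X * (idKraus E a)ᴴ =
      (1 / 2 : ℂ) • (a.elim 1 E * X * (a.elim 1 E)ᴴ) := fun a => by
    rw [idKraus, Matrix.conjTranspose_smul, Complex.star_def, Complex.conj_ofReal,
      Matrix.smul_mul, Matrix.smul_mul, Matrix.mul_smul, smul_smul, h]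
  simp_rw [h2]
  rw [← Finset.smul_sum, Fintype.sum_option]
  simp [withIdentity, hE X]

theorem sum_idKraus [DecidableEq n] {E : κ → Matrix n n ℂ} (hE : ∑ a, (E a)ᴴ * E a = 1) :
    ∑ a, (idKraus E a)ᴴ * idKraus E a = 1 := by
  simp_rw [idKraus_conjTranspose_mul_mul]
  rw [← Finset.smul_sum, Fintype.sum_option]
  simp only [Option.elim_none, Option.elim_some, hE, Matrix.conjTranspose_one, Matrix.one_mul]
  rw [← two_smul ℂ, smul_smul]
  norm_num

end Kraus

/-! ### Entanglement fidelity -/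

section Fidelity

variable {n m r κ : Type*} [Fintype n] [DecidableEq n] [Fintype m] [DecidableEq m] [Fintype r]
  [DecidableEq r] [Fintype κ]

theorem fidelity_ketBra {σ : Matrix n n ℂ} {ψ : n → ℂ} {c : ℝ} (hψ : star ψ ⬝ᵥ ψ = 1)
    (hc : 0 ≤ c) (h : ketBra ψ * σ * ketBra ψ = (c : ℂ) • ketBra ψ) :
    fidelity σ (ketBra ψ) = √c := by
  have hpos : (0 : Matrix n n ℂ) ≤ ketBra ψ :=
    Matrix.nonneg_iff_posSemidef.2 (Matrix.posSemidef_vecMulVec_self_star ψ)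
  have hsq : ketBra ψ * ketBra ψ = ketBra ψ := by
    rw [ketBra, Matrix.vecMulVec_mul_vecMulVec, hψ, one_smul]
  have hs : CFC.sqrt (ketBra ψ) = ketBra ψ := CFC.sqrt_unique hsq hpos
  have hs2 : CFC.sqrt ((c : ℂ) • ketBra ψ) = ((√c : ℝ) : ℂ) • ketBra ψ := by
    refine CFC.sqrt_unique ?_ ?_
    · rw [Matrix.smul_mul, Matrix.mul_smul, smul_smul, hsq, ← Complex.ofReal_mul,
        Real.mul_self_sqrt hc]
    · refine smul_nonneg ?_ hpos
      exact Complex.zero_le_real.2 (Real.sqrt_nonneg c)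
  rw [fidelity, hs, h, hs2, Matrix.trace_smul, ketBra, Matrix.trace_vecMulVec,
    dotProduct_comm, hψ]
  simp

omit [DecidableEq n] [Fintype r] [DecidableEq r] in
theorem IsKrausRep.amplify_ketBra {G : κ → Matrix n n ℂ} {Φ : SuperOp n}
    (hG : IsKrausRep G Φ) (Ψ : Matrix n r ℂ) :
    amplify r Φ (ketBra fun p => Ψ p.1 p.2) = ∑ k, ketBra fun p => (G k * Ψ) p.1 p.2 := by
  ext ⟨i, a⟩ ⟨j, b⟩
  rw [amplify, Matrix.of_apply, hG, Matrix.sum_apply, Matrix.sum_apply]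
  refine Finset.sum_congr rfl fun k _ => ?_
  simp only [ketBra, Matrix.vecMulVec_apply, Matrix.mul_apply, Matrix.of_apply, Pi.star_apply,
    star_sum, star_mul', Matrix.conjTranspose_apply, Finset.mul_sum, Finset.sum_mul]
  refine Finset.sum_congr rfl fun x _ => Finset.sum_congr rfl fun y _ => ?_
  ring

omit [DecidableEq n] [DecidableEq r] in
theorem star_dotProduct_uncurry (Φ Ψ : Matrix n r ℂ) :
    (star (fun p : n × r => Φ p.1 p.2) ⬝ᵥ fun p => Ψ p.1 p.2) = (Φᴴ * Ψ).trace := by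
  rw [dotProduct, Fintype.sum_prod_type_right, Matrix.trace]
  simp [Matrix.mul_apply]

omit [DecidableEq n] [DecidableEq r] in
-- Pythagoras for the projection of `M` onto the unit vector `Ψ`: the best multiple is the overlap.
theorem hsNormSq_sub_smul {M Ψ : Matrix n r ℂ} (hΨ : (Ψᴴ * Ψ).trace = 1) (g : ℂ) :
    hsNormSq (M - g • Ψ) =
      hsNormSq M - ‖(Ψᴴ * M).trace‖ ^ 2 + ‖g - (Ψᴴ * M).trace‖ ^ 2 := by
  have h : (Mᴴ * Ψ).trace = star (Ψᴴ * M).trace := by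
    rw [← Matrix.trace_conjTranspose, Matrix.conjTranspose_mul, Matrix.conjTranspose_conjTranspose]
  rw [hsNormSq, hsNormSq, Matrix.conjTranspose_sub, Matrix.conjTranspose_smul]
  simp only [Matrix.sub_mul, Matrix.mul_sub, Matrix.smul_mul, Matrix.mul_smul, Matrix.trace_sub,
    Matrix.trace_smul, h, hΨ, ← Complex.normSq_eq_norm_sq, Complex.normSq_apply, smul_eq_mul]
  simp
  ring

/-- The entanglement fidelity of a code state is controlled by the Hilbert–Schmidt distance of the
Kraus operators, restricted to the code, from multiples of the encoding map. -/
theorem one_sub_entanglementFidelity_le {G : κ → Matrix n n ℂ} {Φ : SuperOp n}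
    (hG : IsKrausRep G Φ) (h1 : ∑ a, (G a)ᴴ * G a = 1) {V : Matrix n m ℂ} (hV : Vᴴ * V = 1)
    {ρ : Matrix n n ℂ} (hρ : IsCodeState (codeSpace V) ρ) {ψ : n × r → ℂ}
    (hψ : IsPurification ψ ρ) (g : κ → ℂ) :
    1 - entanglementFidelity Φ LinearMap.id ψ ≤ ∑ k, hsNormSq (G k * V - g k • V) := by
  obtain ⟨Ψ, rfl⟩ : ∃ Ψ : Matrix n r ℂ, ψ = fun p => Ψ p.1 p.2 := ⟨Matrix.of fun i a => ψ (i, a), rfl⟩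
  have hρΨ : ρ = Ψ * Ψᴴ := by
    rw [← hψ]
    ext i j
    simp [partialTrace, ketBra, Matrix.vecMulVec_apply, Matrix.mul_apply]
  have hΨ1 : (Ψᴴ * Ψ).trace = 1 := by
    rw [Matrix.trace_mul_comm, ← hρΨ, hρ.1.trace_eq_one]
  have hVρ : V * (Vᴴ * ρ) = ρ := by
    ext i j
    obtain ⟨y, hy⟩ := hρ.2 (Pi.single j 1)
    rw [Matrix.mulVecLin_apply, Matrix.mulVec_single_one] at hy
    have : (V * (Vᴴ * ρ)).col j = ρ.col j := by
      rw [← Matrix.mulVec_single_one, ← Matrix.mulVec_mulVec, ← Matrix.mulVec_mulVec,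
        Matrix.mulVec_single_one, ← hy, Matrix.mulVec_mulVec y Vᴴ V, hV, Matrix.one_mulVec]
    exact congrFun this i
  have hVΨ : V * (Vᴴ * Ψ) = Ψ := by
    -- `Ψ` has the same range as `ρ = Ψ Ψ†`, so it also lies in the code.
    have h0 : (1 - V * Vᴴ) * (Ψ * Ψᴴ) = 0 := by
      rw [← hρΨ, Matrix.sub_mul, Matrix.one_mul, Matrix.mul_assoc, hVρ, sub_self]
    have h2 := (Matrix.mul_self_mul_conjTranspose_eq_zero Ψ (1 - V * Vᴴ)).1 h0
    rw [Matrix.sub_mul, Matrix.one_mul, Matrix.mul_assoc] at h2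
    exact (sub_eq_zero.1 h2).symm
  have hΦ1 : hsNormSq (Vᴴ * Ψ) = 1 := by
    rw [← hsNormSq_isometry_mul hV, hVΨ, hsNormSq, hΨ1, Complex.one_re]
  set t : κ → ℂ := fun k => (Ψᴴ * (G k * Ψ)).trace with ht
  set c : ℝ := ∑ k, ‖t k‖ ^ 2 with hc
  have hc0 : 0 ≤ c := by positivity
  have hunit : (star (fun p : n × r => Ψ p.1 p.2) ⬝ᵥ fun p => Ψ p.1 p.2) = 1 := by
    rw [star_dotProduct_uncurry, hΨ1]
  have hF : entanglementFidelity Φ LinearMap.id (fun p : n × r => Ψ p.1 p.2) = √c := by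
    have hid : amplify r (LinearMap.id : SuperOp n) (ketBra fun p : n × r => Ψ p.1 p.2) =
        ketBra fun p => Ψ p.1 p.2 := rfl
    rw [entanglementFidelity, hid]
    refine fidelity_ketBra hunit hc0 ?_
    rw [hG.amplify_ketBra, Finset.mul_sum, Finset.sum_mul, hc, Complex.ofReal_sum, Finset.sum_smul]
    refine Finset.sum_congr rfl fun k _ => ?_
    have e : (star (fun p : n × r => (G k * Ψ) p.1 p.2) ⬝ᵥ fun p => Ψ p.1 p.2) = star (t k) := by
      rw [star_dotProduct_uncurry, ht, ← Matrix.trace_conjTranspose,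
        Matrix.conjTranspose_mul Ψᴴ, Matrix.conjTranspose_conjTranspose]
    simp only [ketBra]
    rw [Matrix.vecMulVec_mul_vecMulVec, star_dotProduct_uncurry, Matrix.vecMulVec_smul, Matrix.smul_mul,
      Matrix.vecMulVec_mul_vecMulVec, e, Matrix.vecMulVec_smul, smul_smul]
    congr 1
    rw [Complex.star_def, Complex.mul_conj, Complex.normSq_eq_norm_sq]
  have hsum : ∑ k, hsNormSq (G k * Ψ) = 1 := by
    have : ∑ k, (G k * Ψ)ᴴ * (G k * Ψ) = Ψᴴ * Ψ := by
      calc ∑ k, (G k * Ψ)ᴴ * (G k * Ψ) = Ψᴴ * (∑ k, (G k)ᴴ * G k) * Ψ := by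
            rw [Matrix.mul_sum, Matrix.sum_mul]
            simp only [Matrix.conjTranspose_mul, Matrix.mul_assoc]
        _ = _ := by rw [h1, Matrix.mul_one]
    simp only [hsNormSq]
    rw [← Complex.re_sum, ← Matrix.trace_sum, this, hΨ1, Complex.one_re]
  have hc1 : c ≤ 1 := by
    rw [hc, ← hsum]
    refine Finset.sum_le_sum fun k _ => ?_
    have := hsNormSq_sub_smul (M := G k * Ψ) hΨ1 (t k)
    have h3 := hsNormSq_nonneg (G k * Ψ - t k • Ψ)
    simp only [ht, sub_self, norm_zero] at this h3 ⊢
    linarith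
  have hle : 1 - c ≤ ∑ k, hsNormSq (G k * V - g k • V) := by
    rw [hc, ← hsum, ← Finset.sum_sub_distrib]
    refine Finset.sum_le_sum fun k _ => ?_
    have h2 := hsNormSq_sub_smul (M := G k * Ψ) hΨ1 (g k)
    have h3 : G k * Ψ - g k • Ψ = (G k * V - g k • V) * (Vᴴ * Ψ) := by
      rw [Matrix.sub_mul, Matrix.smul_mul, Matrix.mul_assoc, hVΨ]
    have h4 := hsNormSq_mul_le (G k * V - g k • V) (Vᴴ * Ψ)
    rw [hΦ1, mul_one, ← h3] at h4
    have h5 : 0 ≤ ‖g k - (Ψᴴ * (G k * Ψ)).trace‖ ^ 2 := by positivity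
    simp only [ht]
    linarith
  -- The fidelity is `√c`; since `c ≤ 1`, a bound on `1 - c` suffices.
  have hsqrt : c ≤ √c := Real.le_sqrt_of_sq_le (by nlinarith)
  rw [hF]
  linarith

end Fidelity

/-! ### Block embeddings -/

section Blocks

variable {n m κ : Type*} [Fintype n] [DecidableEq n] [Fintype m] [DecidableEq m] [Fintype κ]
  [DecidableEq κ]

/-- The isometry `x ↦ x ⊗ |a⟩`. -/
def blockEmb (m : Type*) {κ : Type*} [DecidableEq m] [DecidableEq κ] (a : κ) :
    Matrix (m × κ) m ℂ :=
  (1 : Matrix (m × κ) (m × κ) ℂ).submatrix id fun j => (j, a)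

theorem mul_blockEmb {p : Type*} (M : Matrix p (m × κ) ℂ) (a : κ) :
    M * blockEmb m a = M.submatrix id fun j => (j, a) := by
  ext i j
  simp [blockEmb, Matrix.mul_apply, Matrix.one_apply]

theorem blockEmb_conjTranspose_mul {p : Type*} (M : Matrix (m × κ) p ℂ) (a : κ) :
    (blockEmb m a)ᴴ * M = M.submatrix (fun j => (j, a)) id := by
  rw [← Matrix.conjTranspose_conjTranspose M, ← Matrix.conjTranspose_mul, mul_blockEmb,
    Matrix.conjTranspose_submatrix]

theorem blockEmb_isometry (a : κ) : (blockEmb m a)ᴴ * blockEmb m a = 1 := by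
  rw [blockEmb_conjTranspose_mul]
  ext i j
  simp [blockEmb, Matrix.one_apply]

theorem sum_blockEmb : ∑ a : κ, blockEmb m a * (blockEmb m a)ᴴ = 1 := by
  ext ⟨i, a⟩ ⟨j, b⟩
  simp [Matrix.sum_apply, Matrix.mul_apply, blockEmb, Matrix.one_apply, ite_and, Prod.ext_iff]

theorem norm_blockEmb_le (a : κ) : ‖blockEmb m a‖ ≤ 1 :=
  norm_le_one_of_conjTranspose_mul_self_le_one (blockEmb_isometry a).le

theorem sum_hsNormSq_blocks (M : Matrix (m × κ) (m × κ) ℂ) :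
    ∑ k : κ × κ, hsNormSq ((blockEmb m k.1)ᴴ * M * blockEmb m k.2) = hsNormSq M := by
  simp only [hsNormSq_eq_sum, mul_blockEmb, blockEmb_conjTranspose_mul, Matrix.submatrix_apply,
    Fintype.sum_prod_type, id]
  rw [Finset.sum_comm' (s := (Finset.univ : Finset m)) (t' := (Finset.univ : Finset κ))
    (s' := fun _ => Finset.univ) (by simp)]
  refine Finset.sum_congr rfl fun a _ => ?_
  rw [Finset.sum_comm]
  refine Finset.sum_congr rfl fun i _ => ?_
  rw [Finset.sum_comm]

/-- The trace splits over the `|κ|²` pairs of blocks; each term is the trace of an `m × m` matrix of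
norm at most `η`. -/
theorem norm_trace_mul_le_of_blocks {Q M : Matrix (m × κ) (m × κ) ℂ} {η : ℝ} (hQ : ‖Q‖ ≤ 1)
    (hM : ∀ a b : κ, ‖(blockEmb m a)ᴴ * M * blockEmb m b‖ ≤ η) :
    ‖(Q * M).trace‖ ≤ (Fintype.card κ : ℝ) ^ 2 * (Fintype.card m * η) := by
  have e : (Q * M).trace = ∑ a : κ, ∑ b : κ,
      ((blockEmb m b)ᴴ * Q * blockEmb m a * ((blockEmb m a)ᴴ * M * blockEmb m b)).trace := by
    have h : Q * M = ∑ a : κ, ∑ b : κ, Q * ((blockEmb m a * (blockEmb m a)ᴴ) * M *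
        (blockEmb m b * (blockEmb m b)ᴴ)) := by
      conv_lhs => rw [← Matrix.one_mul M, ← Matrix.mul_one (1 * M), ← sum_blockEmb]
      rw [Finset.sum_mul, Finset.sum_mul, Finset.mul_sum]
      exact Finset.sum_congr rfl fun a _ => by rw [Finset.mul_sum, Finset.mul_sum]
    rw [h]
    simp only [Matrix.trace_sum]
    refine Finset.sum_congr rfl fun a _ => Finset.sum_congr rfl fun b _ => ?_
    simp only [Matrix.mul_assoc]
    rw [Matrix.trace_mul_comm (blockEmb m b)ᴴ]
    simp only [Matrix.mul_assoc]
  rw [e]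
  have hb : ∀ a b : κ, ‖((blockEmb m b)ᴴ * Q * blockEmb m a *
      ((blockEmb m a)ᴴ * M * blockEmb m b)).trace‖ ≤ Fintype.card m * η := fun a b => by
    refine (norm_trace_le _).trans ?_
    gcongr
    refine (Matrix.l2_opNorm_mul _ _).trans ?_
    have h1 : ‖(blockEmb m b)ᴴ * Q * blockEmb m a‖ ≤ 1 := by
      refine (Matrix.l2_opNorm_mul _ _).trans (mul_le_one₀ ?_ (norm_nonneg _) (norm_blockEmb_le a))
      refine (Matrix.l2_opNorm_mul _ _).trans (mul_le_one₀ ?_ (norm_nonneg _) hQ)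
      rw [Matrix.l2_opNorm_conjTranspose]
      exact norm_blockEmb_le b
    calc _ ≤ 1 * η := mul_le_mul h1 (hM a b) (norm_nonneg _) zero_le_one
      _ = η := one_mul η
  refine (norm_sum_le _ _).trans ?_
  calc ∑ a, _ ≤ ∑ _a : κ, ∑ _b : κ, (Fintype.card m * η : ℝ) :=
        Finset.sum_le_sum fun a _ => (norm_sum_le _ _).trans (Finset.sum_le_sum fun b _ => hb a b)
    _ = _ := by simp; ring

/-- Recovery from the approximate Knill–Laflamme conditions: if all `V† F_a† F_b V` are almost
scalar, there are Kraus operators `G` for which the restrictions of all `G_a F_b` to the code are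
almost multiples of the identity. -/
theorem exists_recovery {V : Matrix n m ℂ} (hV : Vᴴ * V = 1) (F : κ → Matrix n n ℂ) (i : m)
    {η : ℝ} (hη : ∀ a b, ‖(F a * V)ᴴ * (F b * V) -
      ((F a * V)ᴴ * (F b * V)) i i • (1 : Matrix m m ℂ)‖ ≤ η) :
    ∃ (G : Option κ → Matrix n n ℂ) (g : Option κ × κ → ℂ), ∑ a, (G a)ᴴ * G a = 1 ∧
      ∑ k : Option κ × κ, hsNormSq (G k.1 * F k.2 * V - g k • V) ≤
        (Fintype.card κ : ℝ) ^ 2 * (Fintype.card m * η) := by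
  set W : Matrix n (m × κ) ℂ := Matrix.of fun j p => (F p.2 * V) j p.1 with hW
  have hWJ : ∀ a : κ, W * blockEmb m a = F a * V := fun a => by
    rw [mul_blockEmb]; rfl
  obtain ⟨U, hU1, hUW⟩ := exists_polar W
  have hApos : (Wᴴ * W).PosSemidef := Matrix.posSemidef_conjTranspose_mul_self W
  set A := Wᴴ * W with hA
  have hsqA : CFC.sqrt A * CFC.sqrt A = A :=
    CFC.sqrt_mul_sqrt_self A (Matrix.nonneg_iff_posSemidef.2 hApos)
  have hsA : (CFC.sqrt A).PosSemidef := Matrix.nonneg_iff_posSemidef.1 (CFC.sqrt_nonneg A)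
  have hAJ : ∀ a b : κ, (blockEmb m a)ᴴ * A * blockEmb m b = (F a * V)ᴴ * (F b * V) := fun a b => by
    rw [← hWJ, ← hWJ, hA, Matrix.conjTranspose_mul]
    simp only [Matrix.mul_assoc]
  -- Reading the scalars off a single diagonal entry `i` makes `l` a principal submatrix of `A`,
  -- hence positive, so it has a square root.
  set l : Matrix κ κ ℂ := A.submatrix (fun a => (i, a)) (fun a => (i, a)) with hl
  have hlpos : l.PosSemidef := hApos.submatrix _
  have hlAJ : ∀ a b, l a b = ((F a * V)ᴴ * (F b * V)) i i := fun a b => by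
    rw [← hAJ, mul_blockEmb, blockEmb_conjTranspose_mul]; rfl
  set s := CFC.sqrt l with hs
  have hss : s * s = l := CFC.sqrt_mul_sqrt_self l (Matrix.nonneg_iff_posSemidef.2 hlpos)
  have hspos : s.PosSemidef := Matrix.nonneg_iff_posSemidef.1 (CFC.sqrt_nonneg l)
  set B : Matrix (m × κ) (m × κ) ℂ := (1 : Matrix m m ℂ) ⊗ₖ s with hB
  have hBpos : B.PosSemidef := Matrix.PosSemidef.one.kronecker hspos
  have hBB : B * B = (1 : Matrix m m ℂ) ⊗ₖ l := by
    rw [hB, ← Matrix.mul_kronecker_mul, Matrix.one_mul, hss]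
  have hkron : ∀ (x : Matrix κ κ ℂ) (a b : κ),
      (blockEmb m a)ᴴ * ((1 : Matrix m m ℂ) ⊗ₖ x) * blockEmb m b = x a b • (1 : Matrix m m ℂ) :=
    fun x a b => by
      rw [mul_blockEmb, blockEmb_conjTranspose_mul]
      ext j k
      simp [mul_comm]
  have hC0 : (0 : Matrix n n ℂ) ≤ 1 - U * Uᴴ :=
    sub_nonneg.2 (mul_conjTranspose_self_le_one_of_norm_le_one hU1)
  set C := CFC.sqrt (1 - U * Uᴴ) with hC
  have hCC : Cᴴ * C = 1 - U * Uᴴ := by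
    have : Cᴴ = C := (Matrix.nonneg_iff_posSemidef.1 (CFC.sqrt_nonneg (1 - U * Uᴴ))).1
    rw [this, hC, CFC.sqrt_mul_sqrt_self _ hC0]
  -- `C` completes the Kraus family to a trace-preserving one, and it contributes nothing on the
  -- range of `W`, since `U† W = √A` gives `W† U U† W = A`.
  have hCW : C * W = 0 := by
    refine Matrix.conjTranspose_mul_self_eq_zero.1 ?_
    calc (C * W)ᴴ * (C * W) = Wᴴ * (Cᴴ * C) * W := by
          simp only [Matrix.conjTranspose_mul, Matrix.mul_assoc]
      _ = Wᴴ * W - (Uᴴ * W)ᴴ * (Uᴴ * W) := by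
          rw [hCC, Matrix.mul_sub, Matrix.sub_mul, Matrix.mul_one]
          simp only [Matrix.conjTranspose_mul, Matrix.mul_assoc, Matrix.conjTranspose_conjTranspose]
      _ = 0 := by rw [hUW, hsA.1.eq, hsqA, hA, sub_self]
  -- Undo `U`, read off block `a`, and re-encode by `V`; the target multiples are the entries of
  -- `√l`.
  refine ⟨fun a => a.elim C fun a => V * (U * blockEmb m a)ᴴ,
    fun k => k.1.elim 0 fun a => s a k.2, ?_, ?_⟩
  · rw [Fintype.sum_option]
    have h : ∀ a : κ, (V * (U * blockEmb m a)ᴴ)ᴴ * (V * (U * blockEmb m a)ᴴ) =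
        U * (blockEmb m a * (blockEmb m a)ᴴ) * Uᴴ := fun a => by
      rw [Matrix.conjTranspose_mul V, Matrix.mul_assoc, ← Matrix.mul_assoc Vᴴ, hV, Matrix.one_mul]
      simp only [Matrix.conjTranspose_mul, Matrix.mul_assoc, Matrix.conjTranspose_conjTranspose]
    simp only [Option.elim_none, Option.elim_some, h, hCC]
    rw [← Matrix.sum_mul, ← Matrix.mul_sum, sum_blockEmb, Matrix.mul_one, sub_add_cancel]
  · have h0 : ∀ b : κ, hsNormSq (C * F b * V - (0 : ℂ) • V) = 0 := fun b => by
      rw [zero_smul, sub_zero, Matrix.mul_assoc, ← hWJ, ← Matrix.mul_assoc, hCW]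
      simp [hsNormSq]
    have h1 : ∀ a b : κ, hsNormSq (V * (U * blockEmb m a)ᴴ * F b * V - s a b • V) =
        hsNormSq ((blockEmb m a)ᴴ * (CFC.sqrt A - B) * blockEmb m b) := fun a b => by
      rw [← hsNormSq_isometry_mul hV]
      congr 1
      rw [Matrix.mul_sub (blockEmb m a)ᴴ, Matrix.sub_mul, hB, hkron, ← hUW, Matrix.mul_sub,
        Matrix.mul_smul, Matrix.mul_one, Matrix.mul_assoc _ (F b), ← hWJ]
      simp only [Matrix.conjTranspose_mul, Matrix.mul_assoc]
    rw [Fintype.sum_prod_type, Fintype.sum_option]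
    simp only [Option.elim_none, Option.elim_some, h0, h1, Finset.sum_const_zero, zero_add]
    have h2 := sum_hsNormSq_blocks (CFC.sqrt A - B)
    rw [Fintype.sum_prod_type] at h2
    rw [h2]
    obtain ⟨Q, hQ, hle⟩ := exists_contraction_hsNormSq_sub_le hsA hBpos
    refine hle.trans ((Complex.re_le_norm _).trans (norm_trace_mul_le_of_blocks hQ fun a b => ?_))
    rw [hsqA, hBB, Matrix.mul_sub, Matrix.sub_mul, hAJ, hkron, hlAJ]
    exact hη a b

end Blocks

/-! ### Ghost operators -/

section Ghost

variable {n m ι : Type*} [Fintype n] [DecidableEq n] [Fintype m] [DecidableEq m] [Fintype ι]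

omit [Fintype ι] in
theorem HasCompleteGhostSet.nonneg [Nonempty m] {V : Matrix n m ℂ} {E : ι → Matrix n n ℂ} {δ : ℝ}
    (h : HasCompleteGhostSet V E δ) : 0 ≤ δ := by
  obtain ⟨T, hT, -⟩ := h 1 inferInstance
  have := (norm_nonneg _).trans hT.identity
  rwa [norm_one, one_mul] at this

/-- Ghost operators imply approximate Knill–Laflamme conditions. -/
theorem HasCompleteGhostSet.norm_commutator_le {V : Matrix n m ℂ} (hV : Vᴴ * V = 1)
    {E : ι → Matrix n n ℂ} (hE : ∑ a, (E a)ᴴ * E a = 1) {δ : ℝ}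
    (h : HasCompleteGhostSet V E δ) (a b : Option ι) {S : Matrix m m ℂ} (hS : S.IsHermitian) :
    ‖(a.elim 1 E * V)ᴴ * (b.elim 1 E * V) * S - S * ((a.elim 1 E * V)ᴴ * (b.elim 1 E * V))‖ ≤
      2 * δ * ‖S‖ := by
  obtain ⟨T, hT, hTh⟩ := h S (IsSelfAdjoint.isStarNormal hS)
  have hTs := (hTh hS).eq
  have hgh : ∀ c : Option ι, ‖T * (c.elim 1 E * V) - c.elim 1 E * V * S‖ ≤ ‖S‖ * δ := fun c => by
    cases c with
    | none => simpa using hT.identity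
    | some c => simpa only [Option.elim_some, Matrix.mul_assoc] using hT.kraus c
  have hnorm : ∀ c : Option ι, ‖c.elim 1 E * V‖ ≤ 1 := fun c => by
    refine norm_le_one_of_conjTranspose_mul_self_le_one ?_
    have hc : (c.elim 1 E)ᴴ * c.elim 1 E ≤ 1 := by
      cases c with
      | none => simp
      | some c =>
        rw [← hE]
        exact Finset.single_le_sum (f := fun a => (E a)ᴴ * E a) (fun a _ =>
          Matrix.nonneg_iff_posSemidef.2 (Matrix.posSemidef_conjTranspose_mul_self (E a)))
          (Finset.mem_univ c)
    have := (Matrix.le_iff.1 hc).conjTranspose_mul_mul_same V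
    rw [Matrix.mul_sub, Matrix.sub_mul, Matrix.mul_one, hV] at this
    rw [Matrix.le_iff, Matrix.conjTranspose_mul]
    simpa only [Matrix.mul_assoc] using this
  set x := a.elim 1 E * V
  set y := b.elim 1 E * V
  -- The two copies of `x† T y` cancel because `T` is self-adjoint.
  have e : xᴴ * y * S - S * (xᴴ * y) = (T * x - x * S)ᴴ * y - xᴴ * (T * y - y * S) := by
    rw [Matrix.conjTranspose_sub, Matrix.conjTranspose_mul T, Matrix.conjTranspose_mul x, hTs, hS.eq]
    simp only [Matrix.sub_mul, Matrix.mul_sub, Matrix.mul_assoc]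
    abel
  rw [e]
  refine (norm_sub_le _ _).trans ?_
  have h1 : ‖(T * x - x * S)ᴴ * y‖ ≤ ‖S‖ * δ := by
    refine (Matrix.l2_opNorm_mul _ _).trans ?_
    rw [Matrix.l2_opNorm_conjTranspose]
    exact (mul_le_of_le_one_right (norm_nonneg _) (hnorm b)).trans (hgh a)
  have h2 : ‖xᴴ * (T * y - y * S)‖ ≤ ‖S‖ * δ := by
    refine (Matrix.l2_opNorm_mul _ _).trans ?_
    rw [Matrix.l2_opNorm_conjTranspose]
    exact (mul_le_of_le_one_left (norm_nonneg _) (hnorm a)).trans (hgh b)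
  linarith

omit [DecidableEq n] in
theorem finrank_codeSpace {V : Matrix n m ℂ} (hV : Vᴴ * V = 1) :
    Module.finrank ℂ (codeSpace V) = Fintype.card m := by
  have hinj : Function.Injective V.mulVecLin := fun x y hxy => by
    have := congrArg (Vᴴ *ᵥ ·) hxy
    simpa [Matrix.mulVec_mulVec, hV] using this
  rw [codeSpace, LinearMap.finrank_range_of_inj hinj, Module.finrank_fintype_fun_eq_card]

end Ghost

end GhostCode

theorem theoremB3 {n m ι : Type*} [Fintype n] [DecidableEq n] [Fintype m] [DecidableEq m]
    [Fintype ι] (V : Matrix n m ℂ) (hV : Vᴴ * V = 1)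
    (𝓔 : GhostCode.SuperOp n) (h𝓔 : GhostCode.IsChannel 𝓔)
    (K : ι → Matrix n n ℂ) (hK : GhostCode.IsKrausRep K 𝓔)
    (δ : ℝ) (hghost : GhostCode.HasCompleteGhostSet V K δ) :
    GhostCode.IsCorrectable (GhostCode.codeSpace V) (GhostCode.withIdentity 𝓔)
      ((Fintype.card ι + 1 : ℝ) *
        √(2 * (Module.finrank ℂ (GhostCode.codeSpace V) : ℝ) * δ)) := by
  classical
  open GhostCode in
  rw [finrank_codeSpace hV]
  have hE := hK.sum_conjTranspose_mul_self h𝓔.trace_preserving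
  rcases isEmpty_or_nonempty m with hm | ⟨⟨i⟩⟩
  -- A zero code has no states, so the supremum is over the empty set. `δ` may be negative here.
  · refine ⟨LinearMap.id, ⟨fun k X hX => hX, fun X => rfl⟩, Real.sSup_le ?_ (by positivity)⟩
    rintro _ ⟨ρ, k, ψ, hρ, -, -⟩
    have h0 : ρ = 0 := by
      ext p q
      obtain ⟨y, hy⟩ := hρ.2 (Pi.single q 1)
      rw [Subsingleton.elim y 0, map_zero, Matrix.mulVec_single_one] at hy
      exact (congrFun hy p).symm
    have := hρ.1.trace_eq_one
    rw [h0, Matrix.trace_zero] at this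
    exact absurd this zero_ne_one
  · have : Nonempty m := ⟨i⟩
    have hδ := hghost.nonneg
    -- The bound `2 * δ` for Hermitian `S` doubles for general `S`, and the weight `1/2` of each
    -- channel halves it again.
    have hcomm : ∀ a b : Option ι, ‖(idKraus K a * V)ᴴ * (idKraus K b * V) -
        ((idKraus K a * V)ᴴ * (idKraus K b * V)) i i • (1 : Matrix m m ℂ)‖ ≤ 2 * δ :=
      fun a b => by
        have e : (idKraus K a * V)ᴴ * (idKraus K b * V) =
            (1 / 2 : ℂ) • ((a.elim 1 K * V)ᴴ * (b.elim 1 K * V)) := by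
          have := idKraus_conjTranspose_mul_mul K a b
          calc _ = Vᴴ * ((idKraus K a)ᴴ * idKraus K b) * V := by
                simp only [Matrix.conjTranspose_mul, Matrix.mul_assoc]
            _ = _ := by
                rw [this, Matrix.mul_smul, Matrix.smul_mul]
                simp only [Matrix.conjTranspose_mul, Matrix.mul_assoc]
        have h := norm_sub_scalar_le_of_commutator (by positivity)
          (norm_commutator_le_of_hermitian (by positivity)
            fun S hS => hghost.norm_commutator_le hV hE a b hS) i
        rw [e, Matrix.smul_apply, smul_assoc, ← smul_sub, norm_smul]
        have h2 : ‖(1 / 2 : ℂ)‖ = 1 / 2 := by norm_num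
        rw [h2]
        linarith
    obtain ⟨G, g, hG, hle⟩ := exists_recovery hV (idKraus K) i hcomm
    refine ⟨ofKraus G, (isKrausRep_ofKraus G).isChannel hG, Real.sSup_le ?_ (by positivity)⟩
    rintro _ ⟨ρ, k, ψ, hρ, hψ, rfl⟩
    have hF := one_sub_entanglementFidelity_le
      ((isKrausRep_ofKraus G).comp (isKrausRep_idKraus hK))
      (sum_conjTranspose_mul_self_comp hG (sum_idKraus hE)) hV hρ hψ g
    -- The identity is one more Kraus operator, whence `|K| + 1` and `ε² = (|K| + 1)² · dim · 2δ`.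
    refine Real.sqrt_le_iff.2 ⟨by positivity, (hF.trans hle).trans_eq ?_⟩
    rw [mul_pow, Real.sq_sqrt (by positivity), Fintype.card_option]
    push_cast
    ring

end
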